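/- All graphs are finite, simple and have at least one vertex. A graph $G$ is $\beta$-tough ($\beta>0$) if for every integer $p\ge 2$ one cannot obtain a graph with exactly $p$ connected components from $G$ by removing fewer than $p\beta$ vertices. A graph is $3K_2$-free if it has no induced subgraph isomorphic to the disjoint union of three edges. For a positive integer $k$, let $2k\times G$ be the multigraph obtained from $G$ by taking each edge $2k$ times; a $k$-walk in $G$ is a connected spanning subgraph of $2k\times G$ in which every vertex has even degree at most $2k$. Theorem. Every $1$-tough $3K_2$-free graph admits a $2$-walk. -/

import Mathlib

namespace SimpleGraph

/-- `G` is `β`-tough (used for `β > 0`): for every `p ≥ 2`, `G` cannot be split into `p` components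
by removing fewer than `p * β` vertices. -/
def IsTough {V : Type*} [Fintype V] (G : SimpleGraph V) (β : ℝ) : Prop :=
  ∀ (p : ℕ) (S : Finset V), 2 ≤ p →
    Nat.card (G.induce {v : V | v ∉ S}).ConnectedComponent = p → (p : ℝ) * β ≤ (S.card : ℝ)

/-- The graph `ℓK₂`: the disjoint union of `ℓ` edges, the `i`-th one joining `(i, false)` and
`(i, true)`. -/
def disjointEdges (l : ℕ) : SimpleGraph (Fin l × Bool) where
  Adj x y := x.1 = y.1 ∧ x.2 ≠ y.2
  symm := ⟨fun _ _ h => ⟨h.1.symm, h.2.symm⟩⟩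
  loopless := ⟨fun _ h => h.2 rfl⟩

/-- `G` is `ℓK₂`-free: it has no induced subgraph isomorphic to `ℓK₂`. -/
def IsDisjointEdgesFree {V : Type*} (G : SimpleGraph V) (l : ℕ) : Prop :=
  ¬ (disjointEdges l).IsIndContained G

/-- A spanning sub-multigraph of `G` is given by the multiplicity `m e` of every edge `e`.
It is a `k`-walk if it is a subgraph of `2k × G` (the multigraph in which every edge of `G` is
taken `2k` times), is connected, and has all degrees even and at most `2k`. -/
structure IsKWalk {V : Type*} [Fintype V] (G : SimpleGraph V) (k : ℕ) (m : Sym2 V → ℕ) : Prop where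
  eq_zero : ∀ e, e ∉ G.edgeSet → m e = 0
  le_mult : ∀ e, m e ≤ 2 * k
  connected : (SimpleGraph.fromEdgeSet {e : Sym2 V | m e ≠ 0}).Connected
  even_degree : ∀ v, Even (∑ w, m s(v, w))
  degree_le : ∀ v, ∑ w, m s(v, w) ≤ 2 * k

/-- `G` admits a `k`-walk. -/
def HasKWalk {V : Type*} [Fintype V] (G : SimpleGraph V) (k : ℕ) : Prop :=
  ∃ m : Sym2 V → ℕ, G.IsKWalk k m

end SimpleGraph

/-!
A `2`-walk is obtained by superposing two multigraphs whose degrees are all `0` or `2`.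

The first is a perfect `2`-matching: `1`-toughness gives `|N(X)| ≥ |X|` for every set `X` of
vertices, so Hall's theorem yields a permutation `π` with `π x` adjacent to `x`
(`IsTough.exists_perm_adj`), and the edges from `x` to `π x` give every vertex degree `2`. The second
is a cycle that meets every edge of `G`. In their union all degrees are `2` or `4`, and
every vertex off the cycle is joined to its image under `π`, which lies on the cycle; so the union
is connected.

It remains to find a cycle meeting every edge (`IsMinimalCircuit.mem_or_mem`). This is a
Chvátal–Erdős type argument. Take a cycle `C` such that the set of edges avoiding it is
minimal, and suppose that a component `H` of `G - C` has an edge. As `G` has no cut vertex, `H` has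
two neighbours `v`, `v'` on `C`. Let `w` be the successor of `v` on `C`, and choose an edge `wz` where
`z` lies off `C` if possible, and is the successor of `w` otherwise; define `w'z'` likewise from `v'`.
These two edges and an edge of `H` induce a `3K₂`. Indeed, any adjacency between them allows `C` to be
rerouted through `H`, losing only some of those of `w`, `w'` that have no neighbour off `C`. As
`w` and `w'` are nonadjacent, the new cycle avoids no new edge, and it meets an edge of `H`, against
the choice of `C` (`IsMinimalCircuit.false_of_insert`, `IsMinimalCircuit.false_of_cross`).
-/

namespace SimpleGraph

/-! ### Consequences of toughness -/

section Tough

variable {V : Type*} [Fintype V] {G : SimpleGraph V}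

/-- A `1`-tough graph stays connected when at most one vertex is removed: every nontrivial cut of
the remaining vertices is crossed by an edge. -/
theorem IsTough.exists_adj_of_card_le_one (hG : G.IsTough 1) {S : Finset V} (hS : S.card ≤ 1)
    (X : Set V) {x y : V} (hx : x ∈ X) (hy : y ∉ X) (hxS : x ∉ S) (hyS : y ∉ S) :
    ∃ a b, a ∈ X ∧ b ∉ X ∧ a ∉ S ∧ b ∉ S ∧ G.Adj a b := by
  set K := G.induce {v : V | v ∉ S} with hK
  have hcard : Nat.card K.ConnectedComponent ≤ 1 := by
    by_contra! hlt
    have h := hG _ S hlt rfl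
    rw [mul_one, Nat.cast_le] at h
    omega
  have hsub : Subsingleton K.ConnectedComponent := Finite.card_le_one_iff_subsingleton.1 hcard
  have hreach : K.Reachable ⟨x, hxS⟩ ⟨y, hyS⟩ := ConnectedComponent.exact (Subsingleton.elim _ _)
  obtain ⟨p⟩ := hreach
  obtain ⟨d, -, h1, h2⟩ := p.exists_boundary_dart (Subtype.val ⁻¹' X) hx hy
  exact ⟨d.fst, d.snd, h1, h2, d.fst.2, d.snd.2, d.adj⟩

theorem IsTough.exists_adj [Nontrivial V] (hG : G.IsTough 1) (x : V) : ∃ y, G.Adj x y := by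
  obtain ⟨y, hy⟩ := exists_ne x
  obtain ⟨a, b, ha, -, -, -, hab⟩ :=
    hG.exists_adj_of_card_le_one (S := ∅) (by simp) {x} rfl hy (by simp) (by simp)
  exact ⟨b, by rwa [Set.mem_singleton_iff.1 ha] at hab⟩

open Classical in
/-- An independent set `I` of a `1`-tough graph has at least `I.card` neighbours: removing the
neighbours isolates the vertices of `I`. -/
theorem IsTough.card_le_card_biUnion_of_isIndepSet [Nontrivial V] (hG : G.IsTough 1)
    (I : Finset V) (hI : ∀ x ∈ I, ∀ y ∈ I, ¬ G.Adj x y) :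
    I.card ≤ (I.biUnion fun x => G.neighborFinset x).card := by
  set N := I.biUnion fun x => G.neighborFinset x with hN
  have hmem : ∀ x ∈ I, ∀ y, G.Adj x y → y ∈ N := fun x hx y hxy =>
    Finset.mem_biUnion.2 ⟨x, hx, by simpa using hxy⟩
  rcases le_or_gt I.card 1 with h1 | h1
  · rcases I.eq_empty_or_nonempty with rfl | ⟨x, hx⟩
    · simp
    · obtain ⟨y, hy⟩ := hG.exists_adj x
      exact h1.trans (Finset.card_pos.2 ⟨y, hmem x hx y hy⟩)
  · set K := G.induce {v : V | v ∉ N} with hK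
    have hIN : ∀ x ∈ I, x ∉ N := by
      intro x hx hxN
      obtain ⟨y, hy, hyx⟩ := Finset.mem_biUnion.1 hxN
      exact hI y hy x hx (by simpa using hyx)
    have hinj : Function.Injective fun x : I => K.connectedComponentMk ⟨x.1, hIN x.1 x.2⟩ := by
      intro x y hxy
      by_contra hne
      obtain ⟨p⟩ := ConnectedComponent.exact hxy
      obtain ⟨d, -, h1, -⟩ := p.exists_boundary_dart {⟨x.1, hIN x.1 x.2⟩} rfl
        (fun h => hne (Subtype.ext (congrArg Subtype.val h).symm))
      have hadj : G.Adj d.fst.1 d.snd.1 := d.adj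
      rw [Set.mem_singleton_iff.1 h1] at hadj
      exact d.snd.2 (hmem x.1 x.2 _ hadj)
    have hle : I.card ≤ Nat.card K.ConnectedComponent := by
      have := Nat.card_le_card_of_injective _ hinj
      simpa using this
    have h := hG _ N (h1.trans_le hle) rfl
    rw [mul_one, Nat.cast_le] at h
    exact hle.trans h

/-- A `1`-tough graph has a perfect `2`-matching, given here as a permutation moving every vertex
to one of its neighbours. -/
theorem IsTough.exists_perm_adj [Nontrivial V] (hG : G.IsTough 1) :
    ∃ π : Equiv.Perm V, ∀ x, G.Adj x (π x) := by
  classical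
  obtain ⟨f, hf, hadj⟩ := (Finset.all_card_le_biUnion_card_iff_exists_injective
    fun x => G.neighborFinset x).1 fun X => by
      -- The non-isolated vertices of `G[X]` are neighbours of `X` inside `X`, and the neighbours
      -- of the isolated ones lie outside `X`.
      set I := X.filter fun x => ∀ y ∈ X, ¬ G.Adj x y with hI
      have hdisj : Disjoint (X \ I) (I.biUnion fun x => G.neighborFinset x) := by
        rw [Finset.disjoint_left]
        intro y hy hyN
        obtain ⟨x, hx, hxy⟩ := Finset.mem_biUnion.1 hyN
        exact (Finset.mem_filter.1 hx).2 y (Finset.mem_sdiff.1 hy).1 (by simpa using hxy)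
      have hsub : (X \ I) ∪ (I.biUnion fun x => G.neighborFinset x) ⊆
          X.biUnion fun x => G.neighborFinset x := by
        apply Finset.union_subset
        · intro y hy
          obtain ⟨hyX, hyI⟩ := Finset.mem_sdiff.1 hy
          have : ∃ x ∈ X, G.Adj y x := by
            by_contra! h
            exact hyI (Finset.mem_filter.2 ⟨hyX, h⟩)
          obtain ⟨x, hx, hyx⟩ := this
          exact Finset.mem_biUnion.2 ⟨x, hx, by simpa using hyx.symm⟩
        · exact Finset.biUnion_subset_biUnion_of_subset_left _ (Finset.filter_subset _ _)
      have h1 := hG.card_le_card_biUnion_of_isIndepSet I fun x hx y hy =>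
        (Finset.mem_filter.1 hx).2 y (Finset.mem_filter.1 hy).1
      have h2 := Finset.card_le_card hsub
      rw [Finset.card_union_of_disjoint hdisj] at h2
      have hIX : I ⊆ X := Finset.filter_subset _ _
      have h3 : (X \ I).card + I.card = X.card := Finset.card_sdiff_add_card_eq_card hIX
      omega
  exact ⟨Equiv.ofBijective f (Finite.injective_iff_bijective.1 hf), fun x => by
    simpa using hadj x⟩

end Tough

/-! ### Even multigraphs from permutations -/

section PermMult

variable {V : Type*} [DecidableEq V]

/-- The multigraph of a permutation `σ`: one edge from `x` to `σ x` for every `x` that `σ` moves.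
Cycles of length at least three of `σ` become cycles, transpositions become doubled edges. -/
def permMult (σ : Equiv.Perm V) : Sym2 V → ℕ :=
  Sym2.lift ⟨fun x y => (if σ x = y ∧ x ≠ y then 1 else 0) + (if σ y = x ∧ y ≠ x then 1 else 0),
    fun _ _ => add_comm _ _⟩

theorem permMult_mk (σ : Equiv.Perm V) (x y : V) : permMult σ s(x, y) =
    (if σ x = y ∧ x ≠ y then 1 else 0) + (if σ y = x ∧ y ≠ x then 1 else 0) := rfl

theorem permMult_le_two (σ : Equiv.Perm V) (e : Sym2 V) : permMult σ e ≤ 2 := by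
  induction e with
  | _ x y =>
    rw [permMult_mk]
    split_ifs <;> omega

theorem permMult_ne_zero_of_ne {σ : Equiv.Perm V} {x : V} (h : σ x ≠ x) :
    permMult σ s(x, σ x) ≠ 0 := by
  rw [permMult_mk, if_pos ⟨rfl, h.symm⟩]
  omega

theorem permMult_eq_zero {G : SimpleGraph V} {σ : Equiv.Perm V}
    (h : ∀ x, σ x ≠ x → G.Adj x (σ x)) {e : Sym2 V} (he : e ∉ G.edgeSet) : permMult σ e = 0 := by
  induction e with
  | _ x y =>
    rw [mem_edgeSet] at he
    rw [permMult_mk, if_neg, if_neg]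
    · rintro ⟨rfl, hne⟩
      exact he (h y hne.symm).symm
    · rintro ⟨rfl, hne⟩
      exact he (h x hne.symm)

theorem sum_permMult [Fintype V] (σ : Equiv.Perm V) (x : V) :
    ∑ y, permMult σ s(x, y) = if σ x = x then 0 else 2 := by
  simp only [permMult_mk, Finset.sum_add_distrib]
  have h1 : ∀ y, (σ x = y ∧ x ≠ y) ↔ (y = σ x ∧ σ x ≠ x) := fun y =>
    ⟨fun h => ⟨h.1.symm, fun h' => h.2 (h'.symm.trans h.1)⟩,
      fun h => ⟨h.1.symm, fun h' => h.2 (h.1.symm.trans h'.symm)⟩⟩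
  have h2 : ∀ y, (σ y = x ∧ y ≠ x) ↔ (y = σ.symm x ∧ σ x ≠ x) := fun y => by
    rw [Equiv.eq_symm_apply]
    refine and_congr_right fun h => not_congr ⟨fun h' => ?_, fun h' => ?_⟩
    · rwa [h'] at h
    · exact σ.injective (h.trans h'.symm)
  simp only [h1, h2]
  by_cases hx : σ x = x <;> simp [hx]

end PermMult

end SimpleGraph

namespace SimpleGraph

/-! ### Closed lists and the edges they miss -/

section Circuit

variable {V : Type*} {G : SimpleGraph V}

/-- A cycle of `G`, listed in cyclic order. Two adjacent vertices are allowed as a degenerate cycle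
of length two, and one vertex is ruled out because `G` has no loops. -/
structure IsCircuit (G : SimpleGraph V) (l : List V) : Prop where
  nodup : l.Nodup
  ne_nil : l ≠ []
  chain : Cycle.Chain G.Adj (l : Cycle V)

/-- The graph of all edges of `G` that avoid `C`. -/
def outerGraph (G : SimpleGraph V) (C : Set V) : SimpleGraph V where
  Adj x y := G.Adj x y ∧ x ∉ C ∧ y ∉ C
  symm := ⟨fun _ _ h => ⟨h.1.symm, h.2.2, h.2.1⟩⟩
  loopless := ⟨fun _ h => G.loopless.irrefl _ h.1⟩

/-- `l` is a circuit with vertex set `C`, and no circuit misses a proper subset of the edges that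
`l` misses. -/
structure IsMinimalCircuit (G : SimpleGraph V) (C : Set V) (l : List V) : Prop where
  circuit : G.IsCircuit l
  mem_iff : ∀ x, x ∈ l ↔ x ∈ C
  not_lt : ∀ l', G.IsCircuit l' → ¬ G.outerGraph {x | x ∈ l'} < G.outerGraph C

/-- `v` has a neighbour in the component of `h` in `G - C`. -/
def IsAttached (G : SimpleGraph V) (C : Set V) (h v : V) : Prop :=
  ∃ x, (G.outerGraph C).Reachable h x ∧ G.Adj v x

theorem isCircuit_cons {v : V} {l : List V} :
    G.IsCircuit (v :: l) ↔ (v :: l).Nodup ∧ List.IsChain G.Adj (v :: (l ++ [v])) :=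
  ⟨fun h => ⟨h.nodup, (Cycle.chain_coe_cons _ _ _).1 h.chain⟩,
    fun h => ⟨h.1, List.cons_ne_nil _ _, (Cycle.chain_coe_cons _ _ _).2 h.2⟩⟩

theorem IsCircuit.isRotated {l l' : List V} (h : G.IsCircuit l) (hl : l ~r l') :
    G.IsCircuit l' :=
  ⟨hl.nodup_iff.1 h.nodup, fun h' => h.ne_nil (List.isRotated_nil_iff.1 (h' ▸ hl)),
    Cycle.coe_eq_coe.2 hl ▸ h.chain⟩

theorem IsMinimalCircuit.isRotated {C : Set V} {l l' : List V} (h : G.IsMinimalCircuit C l)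
    (hl : l ~r l') : G.IsMinimalCircuit C l' :=
  ⟨h.circuit.isRotated hl, fun x => by rw [← hl.mem_iff, h.mem_iff], h.not_lt⟩

theorem exists_isMinimalCircuit [Finite V] {x y : V} (hxy : G.Adj x y) :
    ∃ C l, G.IsMinimalCircuit C l := by
  have h0 : G.IsCircuit [x, y] :=
    isCircuit_cons.2 ⟨by simpa using hxy.ne, by simpa using ⟨hxy, hxy.symm⟩⟩
  obtain ⟨K, ⟨l, hl, rfl⟩, hmin⟩ := (wellFounded_lt (α := SimpleGraph V)).has_min
    {K | ∃ l, G.IsCircuit l ∧ G.outerGraph {x | x ∈ l} = K} ⟨_, _, h0, rfl⟩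
  exact ⟨_, l, hl, fun _ => Iff.rfl, fun l' hl' => hmin _ ⟨l', hl', rfl⟩⟩

theorem outerGraph_reachable_notMem {C : Set V} {h x : V} (hh : h ∉ C)
    (hx : (G.outerGraph C).Reachable h x) : x ∉ C := by
  intro hxC
  obtain ⟨p⟩ := hx
  obtain ⟨d, -, -, h2⟩ := p.exists_boundary_dart Cᶜ hh (by simpa using hxC)
  exact h2 d.adj.2.2

theorem exists_outerGraph_adj_of_reachable {C : Set V} {h k x : V}
    (hk : (G.outerGraph C).Adj h k) (hx : (G.outerGraph C).Reachable h x) :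
    ∃ y, (G.outerGraph C).Adj x y := by
  by_contra! hno
  obtain ⟨p⟩ := hx
  obtain ⟨d, -, -, h2⟩ := p.exists_boundary_dart {z | z ≠ x}
    (fun e => hno k (e ▸ hk)) (by simp)
  have h2 : d.snd = x := by simpa using h2
  exact hno d.fst (h2 ▸ d.adj.symm)

/-- Two vertices attached to a component of `G - C` are joined by a path through it. -/
theorem IsAttached.exists_detour {C : Set V} {h v w : V} (hh : h ∉ C)
    (hv : G.IsAttached C h v) (hw : G.IsAttached C h w) :
    ∃ P : List V, P ≠ [] ∧ P.Nodup ∧ (∀ z ∈ P, z ∉ C ∧ (G.outerGraph C).Reachable h z) ∧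
      List.IsChain G.Adj (v :: (P ++ [w])) := by
  classical
  obtain ⟨x, hx, hvx⟩ := hv
  obtain ⟨y, hy, hwy⟩ := hw
  obtain ⟨p, hp⟩ := (hx.symm.trans hy).exists_isPath
  refine ⟨p.support, p.support_ne_nil, hp.support_nodup, fun z hz => ?_, ?_⟩
  · have hz' := hx.trans (p.takeUntil z hz).reachable
    exact ⟨outerGraph_reachable_notMem hh hz', hz'⟩
  · have hc : List.IsChain G.Adj p.support :=
      p.isChain_adj_support.imp fun _ _ h => h.1
    have h1 : List.IsChain G.Adj (p.support ++ [w]) := by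
      rw [List.isChain_append]
      refine ⟨hc, List.isChain_singleton _, fun a ha b hb => ?_⟩
      rw [List.getLast?_eq_getLast_of_ne_nil p.support_ne_nil, p.getLast_support] at ha
      simp only [Option.mem_def, Option.some.injEq, List.head?_cons] at ha hb
      exact ha ▸ hb ▸ hwy.symm
    have h2 : p.support ++ [w] = x :: (p.support.tail ++ [w]) := by
      rw [← List.cons_append, p.cons_tail_support]
    rw [h2] at h1 ⊢
    exact List.isChain_cons_cons.2 ⟨hvx, h1⟩

/-- A circuit that picks up a vertex of a nontrivial component of `G - C` and loses only a set `R`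
of pairwise nonadjacent vertices without neighbours outside `C` contradicts minimality. -/
theorem IsMinimalCircuit.false_of_isCircuit {C : Set V} {l l' : List V} {h k z : V}
    (hl : G.IsMinimalCircuit C l) (hk : (G.outerGraph C).Adj h k) (hl' : G.IsCircuit l')
    (hz : z ∈ l') (hhz : (G.outerGraph C).Reachable h z) (R : List V)
    (hR : ∀ x ∈ l, x ∉ l' → x ∈ R) (hRC : ∀ x ∈ R, ∀ y ∉ C, ¬ G.Adj x y)
    (hRR : ∀ x ∈ R, ∀ y ∈ R, ¬ G.Adj x y) : False := by
  obtain ⟨y, hzy⟩ := exists_outerGraph_adj_of_reachable hk hhz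
  have key : ∀ x y, x ∉ l' → y ∉ l' → G.Adj x y → x ∉ C := by
    intro x y hx hy hxy hxC
    have hxR := hR x ((hl.mem_iff x).2 hxC) hx
    by_cases hyC : y ∈ C
    · exact hRR x hxR y (hR y ((hl.mem_iff y).2 hyC) hy) hxy
    · exact hRC x hxR y hyC hxy
  refine hl.not_lt l' hl' (lt_of_le_of_ne ?_ ?_)
  · intro a b hab
    exact ⟨hab.1, key a b hab.2.1 hab.2.2 hab.1, key b a hab.2.2 hab.2.1 hab.1.symm⟩
  · intro heq
    rw [← heq] at hzy
    exact hzy.2.1 hz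

/-- In a minimal circuit `v, R, x, X`, the segment `R` cannot be replaced by a detour. -/
theorem IsMinimalCircuit.false_of_insert {C : Set V} {v x h k : V} {R X : List V}
    (hl : G.IsMinimalCircuit C (v :: (R ++ x :: X))) (hk : (G.outerGraph C).Adj h k)
    (hv : G.IsAttached C h v) (hx : G.IsAttached C h x) (hRC : ∀ a ∈ R, ∀ y ∉ C, ¬ G.Adj a y)
    (hRR : ∀ a ∈ R, ∀ y ∈ R, ¬ G.Adj a y) : False := by
  obtain ⟨P, hP0, hPn, hPC, hPch⟩ := hv.exists_detour hk.2.1 hx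
  obtain ⟨hn, hch⟩ := isCircuit_cons.1 hl.circuit
  have hdis : ∀ z ∈ P, z ∉ v :: (R ++ x :: X) := fun z hz hz' => (hPC z hz).1 ((hl.mem_iff z).1 hz')
  obtain ⟨z, hz⟩ := List.exists_mem_of_ne_nil P hP0
  refine hl.false_of_isCircuit hk (l' := v :: (P ++ x :: X)) (z := z)
    (isCircuit_cons.2 ⟨?_, ?_⟩) (by simp [hz]) (hPC z hz).2 R (by simp; tauto) hRC hRR
  · simp only [List.nodup_cons, List.nodup_append, List.mem_append, List.mem_cons] at hn hdis ⊢
    grind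
  · have hch' : List.IsChain G.Adj ((v :: R) ++ x :: (X ++ [v])) := by simpa using hch
    have : List.IsChain G.Adj ((v :: P) ++ x :: (X ++ [v])) :=
      List.isChain_split.2 ⟨by simpa using hPch, (List.isChain_split.1 hch').2⟩
    simpa using this

/-- In a minimal circuit `v, R, a, A, v', R', b, B` with `v` and `v'` attached to the same nontrivial
component of `G - C`, there is no path `a, Q, b` avoiding `C` and that component: otherwise the
circuit could be rerouted as `v, P, v', Aᵣ, a, Q, b, B` with a detour `P` and `Aᵣ` the reverse
of `A`. -/
theorem IsMinimalCircuit.false_of_cross {C : Set V} {v v' a b h k : V} {R A R' B Q : List V}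
    (hl : G.IsMinimalCircuit C (v :: ((R ++ a :: A) ++ v' :: (R' ++ b :: B))))
    (hk : (G.outerGraph C).Adj h k)
    (hv : G.IsAttached C h v) (hv' : G.IsAttached C h v')
    (hQn : Q.Nodup) (hQ : ∀ z ∈ Q, z ∉ C ∧ ¬ (G.outerGraph C).Reachable h z)
    (hQch : List.IsChain G.Adj (a :: (Q ++ [b])))
    (hRC : ∀ x ∈ R ++ R', ∀ y ∉ C, ¬ G.Adj x y)
    (hRR : ∀ x ∈ R ++ R', ∀ y ∈ R ++ R', ¬ G.Adj x y) : False := by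
  obtain ⟨P, hP0, hPn, hPC, hPch⟩ := hv.exists_detour hk.2.1 hv'
  obtain ⟨hn, hch⟩ := isCircuit_cons.1 hl.circuit
  have hdisP : ∀ z ∈ P, z ∉ v :: ((R ++ a :: A) ++ v' :: (R' ++ b :: B)) :=
    fun z hz hz' => (hPC z hz).1 ((hl.mem_iff z).1 hz')
  have hdisQ : ∀ z ∈ Q, z ∉ v :: ((R ++ a :: A) ++ v' :: (R' ++ b :: B)) :=
    fun z hz hz' => (hQ z hz).1 ((hl.mem_iff z).1 hz')
  have hPQ : ∀ z ∈ P, z ∉ Q := fun z hz hz' => (hQ z hz').2 (hPC z hz).2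
  obtain ⟨z, hz⟩ := List.exists_mem_of_ne_nil P hP0
  refine hl.false_of_isCircuit hk (z := z)
    (l' := v :: (P ++ v' :: (A.reverse ++ a :: (Q ++ b :: B))))
    (isCircuit_cons.2 ⟨?_, ?_⟩) (by simp [hz]) (hPC z hz).2 (R ++ R') (by simp; tauto) hRC hRR
  · simp only [List.nodup_cons, List.nodup_append, List.mem_append, List.mem_cons,
      List.mem_reverse, List.nodup_reverse] at hn hdisP hdisQ ⊢
    grind
  · have hA : List.IsChain G.Adj (a :: (A ++ [v'])) :=
      hch.infix ⟨v :: R, (R' ++ b :: B) ++ [v], by simp⟩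
    have hB : List.IsChain G.Adj (b :: (B ++ [v])) :=
      hch.infix ⟨v :: ((R ++ a :: A) ++ v' :: R'), [], by simp⟩
    have hAr : List.IsChain G.Adj ((v' :: A.reverse) ++ [a]) := by
      have : List.IsChain G.Adj (a :: (A ++ [v'])).reverse :=
        List.isChain_reverse.2 (hA.imp fun _ _ h => h.symm)
      simpa using this
    have h1 : List.IsChain G.Adj ((a :: Q) ++ b :: (B ++ [v])) :=
      List.isChain_split.2 ⟨by simpa using hQch, hB⟩
    have h2 : List.IsChain G.Adj ((v' :: A.reverse) ++ a :: (Q ++ b :: (B ++ [v]))) :=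
      List.isChain_split.2 ⟨hAr, by simpa using h1⟩
    have h3 : List.IsChain G.Adj
        ((v :: P) ++ v' :: (A.reverse ++ a :: (Q ++ b :: (B ++ [v])))) :=
      List.isChain_split.2 ⟨by simpa using hPch, by simpa using h2⟩
    simpa using h3

/-- A vertex `c` from which a path can enter the segment `A` of a circuit with vertex set `C` so
that only a vertex `x` without neighbours outside `C` is left out: the path enters `A` at `a`, which
is the first vertex of `A` or comes right after such an `x`, and `c` is `a` itself or a neighbour of
`a` that lies outside `C` and outside the component of `h`. -/
def IsExit (G : SimpleGraph V) (C : Set V) (h : V) (A : List V) (c : V) : Prop :=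
  ∃ R a A' Q, A = R ++ a :: A' ∧ (∀ x ∈ R, A.head? = some x ∧ ∀ y ∉ C, ¬ G.Adj x y) ∧
    ((Q = [] ∧ c = a) ∨ (Q = [c] ∧ c ∉ C ∧ ¬ (G.outerGraph C).Reachable h c ∧ G.Adj a c))

/-- The segment following an attached vertex `v` starts with a vertex `w` that lies on an edge `wz`
with two exits and without neighbours in the component of `h`. Here `z` is a neighbour of `w`
outside `C` if there is one, and the successor of `w` otherwise. -/
theorem IsMinimalCircuit.exists_edge {C : Set V} {v v' h k : V} {A B : List V}
    (hl : G.IsMinimalCircuit C (v :: (A ++ v' :: B))) (hk : (G.outerGraph C).Adj h k)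
    (hv : G.IsAttached C h v) (hv' : G.IsAttached C h v') :
    ∃ w z, A.head? = some w ∧ G.Adj w z ∧ ¬ G.IsAttached C h w ∧ ¬ G.IsAttached C h z ∧
      G.IsExit C h A w ∧ G.IsExit C h A z := by
  obtain - | ⟨w, A⟩ := A
  · exact (hl.false_of_insert (R := []) hk hv hv' (by simp) (by simp)).elim
  have hw : ¬ G.IsAttached C h w := fun hw =>
    IsMinimalCircuit.false_of_insert (R := []) (X := A ++ v' :: B) hl hk hv hw (by simp) (by simp)
  have hwe : G.IsExit C h (w :: A) w := ⟨[], w, A, [], rfl, by simp, Or.inl ⟨rfl, rfl⟩⟩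
  by_cases hy : ∃ y ∉ C, G.Adj w y
  · obtain ⟨y, hyC, hwy⟩ := hy
    have hhy : ¬ (G.outerGraph C).Reachable h y := fun hr => hw ⟨y, hr, hwy⟩
    refine ⟨w, y, rfl, hwy, hw, ?_, hwe,
      [], w, A, [y], rfl, by simp, Or.inr ⟨rfl, hyC, hhy, hwy⟩⟩
    rintro ⟨x, hx, hyx⟩
    have hxy : (G.outerGraph C).Adj x y :=
      ⟨hyx.symm, outerGraph_reachable_notMem hk.2.1 hx, hyC⟩
    exact hhy (hx.trans hxy.reachable)
  · push Not at hy
    have hR : ∀ a ∈ [w], ∀ y ∉ C, ¬ G.Adj a y := by simpa using hy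
    have hRR : ∀ a ∈ [w], ∀ y ∈ [w], ¬ G.Adj a y := by simp
    obtain - | ⟨z, A⟩ := A
    · exact (hl.false_of_insert (R := [w]) hk hv hv' hR hRR).elim
    have hwz : G.Adj w z := by
      have := (isCircuit_cons.1 hl.circuit).2
      simp only [List.cons_append, List.isChain_cons_cons] at this
      exact this.2.1
    exact ⟨w, z, rfl, hwz, hw, fun hz => IsMinimalCircuit.false_of_insert (R := [w])
      (X := A ++ v' :: B) hl hk hv hz hR hRR, hwe,
      [w], z, A, [], rfl, by simpa using hy, Or.inl ⟨rfl, rfl⟩⟩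

/-- Exits of the two segments are nonadjacent, provided that this holds for the first vertices of
the segments. -/
theorem IsMinimalCircuit.not_adj_of_isExit {C : Set V} {v v' h k c c' : V} {A B : List V}
    (hl : G.IsMinimalCircuit C (v :: (A ++ v' :: B))) (hk : (G.outerGraph C).Adj h k)
    (hv : G.IsAttached C h v) (hv' : G.IsAttached C h v')
    (hhead : ∀ w w', A.head? = some w → B.head? = some w' → ¬ G.Adj w w')
    (hc : G.IsExit C h A c) (hc' : G.IsExit C h B c') : ¬ G.Adj c c' := by
  intro hadj
  obtain ⟨R, a, A', Q, rfl, hR, hQ⟩ := hc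
  obtain ⟨R', b, B', Q', rfl, hR', hQ'⟩ := hc'
  have hRR : ∀ x ∈ R ++ R', ∀ y ∈ R ++ R', ¬ G.Adj x y := by
    intro x hx y hy hxy
    rcases List.mem_append.1 hx with hx | hx <;> rcases List.mem_append.1 hy with hy | hy
    · exact hxy.ne (Option.some.inj ((hR x hx).1.symm.trans (hR y hy).1))
    · exact hhead x y (hR x hx).1 (hR' y hy).1 hxy
    · exact hhead y x (hR y hy).1 (hR' x hx).1 hxy.symm
    · exact hxy.ne (Option.some.inj ((hR' x hx).1.symm.trans (hR' y hy).1))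
  have hRC : ∀ x ∈ R ++ R', ∀ y ∉ C, ¬ G.Adj x y := by
    intro x hx
    rcases List.mem_append.1 hx with hx | hx
    · exact (hR x hx).2
    · exact (hR' x hx).2
  have hne := hadj.ne
  refine hl.false_of_cross hk hv hv' (Q := Q ++ Q') ?_ ?_ ?_ hRC hRR
  · rcases hQ with ⟨rfl, rfl⟩ | ⟨rfl, hQ⟩ <;> rcases hQ' with ⟨rfl, rfl⟩ | ⟨rfl, hQ'⟩ <;>
      simp [hne]
  · rcases hQ with ⟨rfl, rfl⟩ | ⟨rfl, hQ⟩ <;> rcases hQ' with ⟨rfl, rfl⟩ | ⟨rfl, hQ'⟩ <;>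
      simp <;> tauto
  · rcases hQ with ⟨rfl, rfl⟩ | ⟨rfl, hQ⟩ <;> rcases hQ' with ⟨rfl, rfl⟩ | ⟨rfl, hQ'⟩ <;>
      simp [hadj]
    · exact hQ'.2.2.symm
    · exact hQ.2.2
    · exact ⟨hQ.2.2, hQ'.2.2.symm⟩

theorem IsMinimalCircuit.head_not_adj {C : Set V} {v v' h k : V} {A B : List V}
    (hl : G.IsMinimalCircuit C (v :: (A ++ v' :: B))) (hk : (G.outerGraph C).Adj h k)
    (hv : G.IsAttached C h v) (hv' : G.IsAttached C h v') {w w' : V}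
    (hw : A.head? = some w) (hw' : B.head? = some w') : ¬ G.Adj w w' := by
  intro hadj
  obtain - | ⟨a, A⟩ := A
  · simp at hw
  obtain - | ⟨b, B⟩ := B
  · simp at hw'
  obtain rfl : a = w := by simpa using hw
  obtain rfl : b = w' := by simpa using hw'
  exact IsMinimalCircuit.false_of_cross (R := []) (R' := []) (Q := []) hl hk hv hv' (by simp)
    (by simp) (by simpa using hadj) (by simp) (by simp)

/-- Three edges without edges between them induce a `3K₂`; that their ends are distinct is
automatic. -/
theorem IsDisjointEdgesFree.false_of_adj (hfree : G.IsDisjointEdgesFree 3) (f : Fin 3 → Bool → V)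
    (hf : ∀ i, G.Adj (f i false) (f i true))
    (hn : ∀ i j, i < j → ∀ b c, ¬ G.Adj (f i b) (f j c)) : False := by
  have hn' : ∀ i j, i ≠ j → ∀ b c, ¬ G.Adj (f i b) (f j c) := by
    intro i j hij b c hadj
    rcases lt_or_gt_of_ne hij with h | h
    · exact hn i j h b c hadj
    · exact hn j i h c b hadj.symm
  have hadj : ∀ i b c, G.Adj (f i b) (f i c) ↔ b ≠ c := by
    intro i b c
    cases b <;> cases c <;> simp [hf i, (hf i).symm]
  have hinj : Function.Injective fun x : Fin 3 × Bool => f x.1 x.2 := by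
    rintro ⟨i, b⟩ ⟨j, c⟩ h
    simp only at h
    by_cases hij : i = j
    · subst hij
      have hbc : b = c := by
        by_contra hbc
        have := (hadj i b c).2 hbc
        rw [h] at this
        exact this.ne rfl
      rw [hbc]
    · have := (hadj i b (!b)).2 (by simp)
      rw [h] at this
      exact (hn' j i (Ne.symm hij) _ _ this).elim
  refine hfree ⟨⟨⟨_, hinj⟩, ?_⟩⟩
  rintro ⟨i, b⟩ ⟨j, c⟩
  simp only [Function.Embedding.coeFn_mk, disjointEdges]
  by_cases hij : i = j
  · subst hij
    simp [hadj]
  · simp [hij, hn' i j hij]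

/-- A nontrivial component of `G - C` is attached to at most one vertex of `C`: with two such
vertices, an edge of the component and the edges that `IsMinimalCircuit.exists_edge` provides
behind the two vertices would induce a `3K₂`. -/
theorem IsMinimalCircuit.eq_of_isAttached {C : Set V} {l : List V} {h k v v' : V}
    (hl : G.IsMinimalCircuit C l) (hfree : G.IsDisjointEdgesFree 3)
    (hk : (G.outerGraph C).Adj h k) (hvC : v ∈ C) (hvC' : v' ∈ C)
    (hv : G.IsAttached C h v) (hv' : G.IsAttached C h v') : v = v' := by
  by_contra hne
  obtain ⟨A, B, hrot⟩ : ∃ A B, l ~r v :: (A ++ v' :: B) := by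
    obtain ⟨s, t, rfl⟩ := List.append_of_mem ((hl.mem_iff v).2 hvC)
    have hrot : s ++ v :: t ~r v :: (t ++ s) := by
      simpa using List.isRotated_append (l := s) (l' := v :: t)
    have hmem : v' ∈ t ++ s := by
      have := (hrot.mem_iff).1 ((hl.mem_iff v').2 hvC')
      simpa [Ne.symm hne] using this
    obtain ⟨A, B, hAB⟩ := List.append_of_mem hmem
    exact ⟨A, B, hAB ▸ hrot⟩
  have hl₁ := hl.isRotated hrot
  have hl₂ : G.IsMinimalCircuit C (v' :: (B ++ v :: A)) := hl₁.isRotated (by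
    simpa using List.isRotated_append (l := v :: A) (l' := v' :: B))
  obtain ⟨w, z, hw, hwz, hwa, hza, hwe, hze⟩ := hl₁.exists_edge hk hv hv'
  obtain ⟨w', z', hw', hwz', hwa', hza', hwe', hze'⟩ := hl₂.exists_edge hk hv' hv
  have hhead : ∀ w w', A.head? = some w → B.head? = some w' → ¬ G.Adj w w' :=
    fun _ _ hw hw' => hl₁.head_not_adj hk hv hv' hw hw'
  have hcross : ∀ c c', G.IsExit C h A c → G.IsExit C h B c' → ¬ G.Adj c c' :=
    fun _ _ hc hc' => hl₁.not_adj_of_isExit hk hv hv' hhead hc hc'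
  have hH : ∀ c, ¬ G.IsAttached C h c → ¬ G.Adj h c ∧ ¬ G.Adj k c := fun c hc =>
    ⟨fun hadj => hc ⟨h, Reachable.refl _, hadj.symm⟩, fun hadj => hc ⟨k, hk.reachable, hadj.symm⟩⟩
  refine hfree.false_of_adj
    (fun i b => if b then ![k, z, z'] i else ![h, w, w'] i) ?_ ?_
  · intro i
    fin_cases i
    exacts [hk.1, hwz, hwz']
  · intro i j hij b c
    fin_cases i <;> fin_cases j <;> first | exact absurd hij (by decide) | skip
    · cases b <;> cases c
      exacts [(hH w hwa).1, (hH z hza).1, (hH w hwa).2, (hH z hza).2]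
    · cases b <;> cases c
      exacts [(hH w' hwa').1, (hH z' hza').1, (hH w' hwa').2, (hH z' hza').2]
    · cases b <;> cases c
      exacts [hcross w w' hwe hwe', hcross w z' hwe hze', hcross z w' hze hwe',
        hcross z z' hze hze']

/-- In a `1`-tough `3K₂`-free graph, a minimal circuit meets every edge. -/
theorem IsMinimalCircuit.mem_or_mem [Fintype V] {C : Set V} {l : List V}
    (hl : G.IsMinimalCircuit C l) (hG : G.IsTough 1) (hfree : G.IsDisjointEdgesFree 3) {h k : V}
    (hhk : G.Adj h k) : h ∈ C ∨ k ∈ C := by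
  by_contra! hC
  have hk : (G.outerGraph C).Adj h k := ⟨hhk, hC⟩
  -- Since `G` has no cut vertex, the component of `h` is attached to a vertex other than `u`.
  have key : ∀ u ∈ C, ∃ v ∈ C, v ≠ u ∧ G.IsAttached C h v := by
    intro u hu
    obtain ⟨c, hcC, hcu⟩ : ∃ c ∈ C, c ≠ u := by
      obtain ⟨s, t, rfl⟩ := List.append_of_mem ((hl.mem_iff u).2 hu)
      have hrot : s ++ u :: t ~r u :: (t ++ s) := by
        simpa using List.isRotated_append (l := s) (l' := u :: t)
      have hl₁ := hl.isRotated hrot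
      obtain ⟨hn, hch⟩ := isCircuit_cons.1 hl₁.circuit
      rcases hts : t ++ s with - | ⟨c, X⟩
      · simp [hts] at hch
      · rw [hts] at hn hl₁
        refine ⟨c, (hl₁.mem_iff c).1 (by simp), ?_⟩
        rintro rfl
        simp at hn
    have hself : ∀ x, (G.outerGraph C).Reachable h x → x ∉ C := fun x hx =>
      outerGraph_reachable_notMem hC.1 hx
    obtain ⟨a, b, ha, hb, -, hbu, hab⟩ := hG.exists_adj_of_card_le_one (S := {u}) (by simp)
      {x | (G.outerGraph C).Reachable h x} (x := h) (y := c) (Reachable.refl _)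
      (fun hr => hself c hr hcC) (fun e => hC.1 (Finset.mem_singleton.1 e ▸ hu)) (by simpa using hcu)
    refine ⟨b, ?_, by simpa using hbu, a, ha, hab.symm⟩
    by_contra hbC
    have hab' : (G.outerGraph C).Adj a b := ⟨hab, hself a ha, hbC⟩
    exact hb (Reachable.trans ha hab'.reachable)
  obtain ⟨u, hu⟩ := List.exists_mem_of_ne_nil l hl.circuit.ne_nil
  obtain ⟨v, hvC, -, hv⟩ := key u ((hl.mem_iff u).1 hu)
  obtain ⟨v', hvC', hne, hv'⟩ := key v hvC
  exact hne (hl.eq_of_isAttached hfree hk hvC' hvC hv' hv)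

end Circuit

end SimpleGraph

namespace SimpleGraph

/-! ### Assembling the walk -/

/-- The permutation that moves every vertex of a circuit to its successor. -/
theorem IsCircuit.exists_perm {V : Type*} [Finite V] {G : SimpleGraph V} {l : List V}
    (hl : G.IsCircuit l) :
    ∃ σ : Equiv.Perm V, (∀ x, x ∉ l → σ x = x) ∧ (∀ x ∈ l, G.Adj x (σ x)) ∧
      ∀ x ∈ l, ∀ y ∈ l, ∃ n : ℕ, (σ ^ n) x = y := by
  classical
  have key : ∀ x ∈ l, 2 ≤ l.length ∧ G.Adj x (l.formPerm x) := by
    intro x hx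
    obtain ⟨s, t, rfl⟩ := List.append_of_mem hx
    have hrot : s ++ x :: t ~r x :: (t ++ s) := by
      simpa using List.isRotated_append (l := s) (l' := x :: t)
    rw [List.formPerm_eq_of_isRotated hl.nodup hrot, hrot.perm.length_eq]
    obtain ⟨hn, hch⟩ := isCircuit_cons.1 (hl.isRotated hrot)
    rcases hts : t ++ s with - | ⟨y, X⟩
    · simp [hts] at hch
    · rw [hts] at hn hch
      rw [List.formPerm_apply_head _ _ _ hn]
      exact ⟨by simp, (List.isChain_cons_cons.1 hch).1⟩
  refine ⟨l.formPerm, fun x hx => List.formPerm_apply_of_notMem hx, fun x hx => (key x hx).2,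
    fun x hx y hy => ?_⟩
  exact ((List.isCycle_formPerm hl.nodup (key x hx).1).sameCycle (key x hx).2.ne'
    (key y hy).2.ne').exists_nat_pow_eq

end SimpleGraph

theorem theorem4 {V : Type*} [Fintype V] [Nonempty V] (G : SimpleGraph V)
    (hG : G.IsTough 1) (hfree : G.IsDisjointEdgesFree 3) :
    G.HasKWalk 2 := by
  classical
  rcases subsingleton_or_nontrivial V with hV | hV
  · refine ⟨fun _ => 0, fun _ _ => rfl, by simp, ⟨fun x y => ?_⟩, by simp, by simp⟩
    rw [Subsingleton.elim x y]
  obtain ⟨π, hπ⟩ := hG.exists_perm_adj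
  obtain ⟨x₀⟩ := ‹Nonempty V›
  obtain ⟨y₀, hxy₀⟩ := hG.exists_adj x₀
  obtain ⟨C, l, hl⟩ := SimpleGraph.exists_isMinimalCircuit hxy₀
  obtain ⟨σ, hσ, hσadj, hσpow⟩ := hl.circuit.exists_perm
  have hπne : ∀ x, π x ≠ x := fun x => (hπ x).ne'
  have hσne : ∀ x, σ x ≠ x → G.Adj x (σ x) := fun x hx =>
    hσadj x (by_contra fun h => hx (hσ x h))
  have hdeg : ∀ x, ∑ y, (SimpleGraph.permMult σ s(x, y) + SimpleGraph.permMult π s(x, y)) =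
      (if σ x = x then 0 else 2) + 2 := fun x => by
    rw [Finset.sum_add_distrib, SimpleGraph.sum_permMult, SimpleGraph.sum_permMult,
      if_neg (hπne x)]
  refine ⟨fun e => SimpleGraph.permMult σ e + SimpleGraph.permMult π e, ?_, ?_, ?_, ?_, ?_⟩
  · intro e he
    rw [SimpleGraph.permMult_eq_zero hσne he,
      SimpleGraph.permMult_eq_zero (fun x _ => hπ x) he]
  · intro e
    have h1 := SimpleGraph.permMult_le_two σ e
    have h2 := SimpleGraph.permMult_le_two π e
    omega
  · set K := SimpleGraph.fromEdgeSet {e : Sym2 V |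
      SimpleGraph.permMult σ e + SimpleGraph.permMult π e ≠ 0} with hK
    have hKσ : ∀ x, K.Reachable x (σ x) := by
      intro x
      by_cases hx : σ x = x
      · rw [hx]
      · refine SimpleGraph.Adj.reachable ((SimpleGraph.fromEdgeSet_adj _).2 ⟨?_, Ne.symm hx⟩)
        have := SimpleGraph.permMult_ne_zero_of_ne hx
        simp only [Set.mem_ofPred_eq]
        omega
    have hKπ : ∀ x, K.Reachable x (π x) := by
      intro x
      refine SimpleGraph.Adj.reachable ((SimpleGraph.fromEdgeSet_adj _).2 ⟨?_, (hπne x).symm⟩)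
      have := SimpleGraph.permMult_ne_zero_of_ne (hπne x)
      simp only [Set.mem_ofPred_eq]
      omega
    have hpow : ∀ (n : ℕ) x, K.Reachable x ((σ ^ n) x) := by
      intro n
      induction n with
      | zero => exact fun x => SimpleGraph.Reachable.refl _
      | succ n ih =>
        intro x
        rw [pow_succ', Equiv.Perm.mul_apply]
        exact (ih x).trans (hKσ _)
    have hC : ∀ x ∈ C, ∀ y ∈ C, K.Reachable x y := by
      intro x hx y hy
      obtain ⟨n, rfl⟩ := hσpow x ((hl.mem_iff x).2 hx) y ((hl.mem_iff y).2 hy)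
      exact hpow n x
    have hto : ∀ x, ∃ y ∈ C, K.Reachable x y := by
      intro x
      rcases hl.mem_or_mem hG hfree (hπ x) with h | h
      · exact ⟨x, h, SimpleGraph.Reachable.refl _⟩
      · exact ⟨π x, h, hKπ x⟩
    refine ⟨fun x y => ?_⟩
    obtain ⟨x', hx', hxx'⟩ := hto x
    obtain ⟨y', hy', hyy'⟩ := hto y
    exact hxx'.trans ((hC x' hx' y' hy').trans hyy'.symm)
  · intro x
    rw [hdeg]
    split_ifs <;> decide
  · intro x
    rw [hdeg]
    split_ifs <;> decide
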